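/- Let $(a_n)_{n\ge 1}$ be a sequence of positive integers, and write $[N]=\{1,\dots,N\}$. Suppose that for every $N_0\in\mathbb N$, $C>0$ and $\varepsilon>0$ there exist an integer $r$, integers $N_1,\dots,N_r\ge N_0$ and bounded intervals $J_1,\dots,J_r\subseteq\mathbb R$ such that \[ \frac{\#\{n\in[N_i]: a_n\in J_i\}}{N_i}\ \ge\ 1-\varepsilon\quad\text{for every } i\in[r], \qquad\text{and}\qquad \frac{\bigl|\bigcup_{i\in[r]}J_i\bigr|}{\max_{i\in[r]}|J_i|}\ >\ C, \] where $|\cdot|$ denotes length (Lebesgue measure). Then $(a_n)$ has the strong sweeping out property (for Cesàro averages): for every compact metric space $X$ with its Borel $\sigma$-algebra $\mathcal B$, every non-atomic Borel probability measure $\mu$ on $X$, every ergodic $\mu$-preserving (not necessarily invertible) transformation $T\colon X\to X$ and every $\varepsilon>0$, there is a set $A\in\mathcal B$ with $\mu(A)<\varepsilon$ such that for $\mu$-almost every $x\in X$ \[ \limsup_{N\to\infty}\frac1N\sum_{n=1}^N \mathbf 1_A(T^{a_n}x)=1 \quad\text{and}\quad \liminf_{N\to\infty}\frac1N\sum_{n=1}^N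 \mathbf 1_A(T^{a_n}x)=0 . \] -/

import Mathlib

open MeasureTheory Filter

universe u

/-- The Cesàro average `(1/N) ∑_{n=1}^N 1_A(T^{a_n} x)`. -/
noncomputable def cesaroVisits {X : Type*} (T : X → X) (a : ℕ → ℕ) (A : Set X) (x : X)
    (N : ℕ) : ℝ :=
  (∑ n ∈ Finset.Icc 1 N, A.indicator (fun _ => (1 : ℝ)) (T^[a n] x)) / N

/-- The sequence `a_1, a_2, …` has the strong sweeping out property (for Cesàro averages).
Measure-preserving systems live on compact metric spaces with a Borel probability measure, and
the transformation need not be invertible; on such a space a measure is non-atomic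
exactly when points have measure zero. -/
def StrongSweepingOut (a : ℕ → ℕ) : Prop :=
  ∀ (X : Type u) [MetricSpace X] [CompactSpace X] [MeasurableSpace X] [BorelSpace X]
    (μ : Measure X) [IsProbabilityMeasure μ] [NullSingletonClass μ] (T : X → X), Ergodic T μ →
    ∀ ε : ℝ, 0 < ε → ∃ A : Set X, MeasurableSet A ∧ μ A < ENNReal.ofReal ε ∧
      ∀ᵐ x ∂μ, limsup (cesaroVisits T a A x) atTop = 1 ∧
        liminf (cesaroVisits T a A x) atTop = 0

/-- The interval condition: for all `N₀`, `C > 0`, `ε > 0` there are finitely many times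
`N_i ≥ N₀` and bounded intervals `J_i ⊆ ℝ` such that at least the fraction `1 - ε` of
`a_1, …, a_{N_i}` lies in `J_i`, while the length of `⋃ J_i` exceeds `C` times the largest of the
lengths `|J_i|`. -/
def IntervalCondition (a : ℕ → ℕ) : Prop :=
  ∀ (N₀ : ℕ) (C ε : ℝ), 0 < C → 0 < ε →
    ∃ (r : ℕ) (N : Fin r → ℕ) (J : Fin r → Set ℝ),
      (∀ i, N₀ ≤ N i) ∧
      (∀ i, (J i).OrdConnected ∧ Bornology.IsBounded (J i)) ∧
      (∀ i, 1 - ε ≤ ({n : ℕ | 1 ≤ n ∧ n ≤ N i ∧ (a n : ℝ) ∈ J i}.ncard : ℝ) / (N i : ℝ)) ∧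
      C < volume.real (⋃ i, J i) / ⨆ i, volume.real (J i)

/-! The core is `IntervalCondition.exists_sweeping`: a set `D` of tiny measure such that almost all
of the space sees a Cesàro average close to 1 within a bounded range of times. The hypothesis yields
a set `U` of integers, far larger than `2L+1`, such that for each `u ∈ U` most of some initial block
of `a` lies within `L` of `u`. Consider the rotation by `-1` on `ZMod q`, with `I = [-L, L]` and `V`
the image of `U`: a point of `s + V` spends most of the times `a_n` in `s + I`. Since `V` is much
larger than `I`, suitable translates of `I` have small total mass while the same translates of `V`
cover nearly everything (`exists_translates`).

The rotation is transferred to `T` by the hitting time of a very small set `B`, taken mod `q`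
(`Ergodic.exists_phase`). This replaces a Rokhlin tower and needs no invertibility.

Finally, sets `D k` of rapidly decreasing measure are combined: `A` consists of the points whose
last `D k` has even index. By Borel–Cantelli, almost every orbit eventually misses all later `D j`
during the `k`-th range of times, so even `k` give averages near 1 and odd `k` averages near 0. -/

/-! ### From real intervals to integer points -/

/-- `U` is the set of integers in `⋃ J i` and `L` the floor of the largest length. The bound `M` on
the times is what later lets `B` be chosen after them. -/
theorem IntervalCondition.exists_finset {a : ℕ → ℕ} (h : IntervalCondition a) (N₀ : ℕ)
    {K ε : ℝ} (hK : 0 < K) (hε : 0 < ε) (hε1 : ε < 1) :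
    ∃ (U : Finset ℤ) (L M : ℕ), K * (2 * L + 1) ≤ U.card ∧ ∀ u ∈ U, ∃ N, N₀ ≤ N ∧ N ≤ M ∧
      (1 - ε) * N ≤ ((Finset.Icc 1 N).filter (fun n => |u - (a n : ℤ)| ≤ L)).card := by
  -- `N₀ + 1` keeps the denominators positive. The 6 is a factor 2 from the ball diameters below
  -- times a factor 3 from `2ℓ + 1 ≤ 3 max(1, ℓ)`.
  obtain ⟨r, N, J, hN, hJ, hcount, hC⟩ := h (N₀ + 1) (6 * K) ε (by positivity) hε
  set ℓ : ℝ := ⨆ i, volume.real (J i) with hℓ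
  have hvol0 : 0 ≤ volume.real (⋃ i, J i) := measureReal_nonneg
  have hℓ0 : 0 < ℓ := by
    rcases lt_trichotomy ℓ 0 with h0 | h0 | h0
    · have := div_nonpos_of_nonneg_of_nonpos hvol0 h0.le
      linarith
    · rw [h0, div_zero] at hC
      linarith
    · exact h0
  rw [lt_div_iff₀ hℓ0] at hC
  have hdist : ∀ i, ∀ y ∈ J i, ∀ z ∈ J i, |y - z| ≤ ℓ := by
    intro i y hy z hz
    have h1 : volume.real (Set.uIcc y z) ≤ volume.real (J i) :=
      measureReal_mono ((hJ i).1.uIcc_subset hy hz) (hJ i).2.measure_lt_top.ne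
    have h2 : volume.real (J i) ≤ ℓ := le_ciSup (f := fun i => volume.real (J i))
      (Set.finite_range _).bddAbove i
    rw [Measure.real, Real.volume_interval, ENNReal.toReal_ofReal (abs_nonneg _)] at h1
    rw [abs_sub_comm]
    linarith
  have hbdd : Bornology.IsBounded (⋃ i, J i) :=
    Bornology.isBounded_iUnion.2 fun i => (hJ i).2
  have hfin : {z : ℤ | (z : ℝ) ∈ ⋃ i, J i}.Finite := by
    obtain ⟨R, hR⟩ := hbdd.subset_closedBall 0
    refine (Set.finite_Icc (-⌈R⌉) ⌈R⌉).subset fun z hz => ?_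
    have := hR hz
    rw [Metric.mem_closedBall, Real.dist_eq, sub_zero, abs_le] at this
    have h3 := Int.le_ceil R
    constructor
    · have : (-⌈R⌉ : ℝ) ≤ z := by linarith
      exact_mod_cast this
    · have : (z : ℝ) ≤ ⌈R⌉ := by linarith
      exact_mod_cast this
  have hmem : ∀ i, ∃ n, (a n : ℝ) ∈ J i := by
    intro i
    by_contra! hne
    have := hcount i
    simp only [hne, and_false, Set.ofPred_false, Set.ncard_empty, Nat.cast_zero, zero_div] at this
    linarith
  -- Each `J i` contains some integer `a n`, so rounding a point of `J i` towards `a n` stays in `J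
  -- i`. Radius 1 alone would be too weak when `ℓ < 1`.
  have hcover : (⋃ i, J i) ⊆ ⋃ u ∈ hfin.toFinset, Metric.closedBall (u : ℝ) (min 1 ℓ) := by
    intro y hy
    obtain ⟨i, hi⟩ := Set.mem_iUnion.1 hy
    obtain ⟨n, hn⟩ := hmem i
    suffices ∃ u : ℤ, (u : ℝ) ∈ J i ∧ |y - u| ≤ 1 by
      obtain ⟨u, hu, hyu⟩ := this
      refine Set.mem_iUnion₂.2 ⟨u, by simpa using ⟨i, hu⟩, ?_⟩
      rw [Metric.mem_closedBall, Real.dist_eq]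
      exact le_min hyu (hdist i y hi u hu)
    rcases le_total y (a n) with hle | hle
    · refine ⟨⌈y⌉, (hJ i).1.out hi hn ⟨Int.le_ceil y, ?_⟩, ?_⟩
      · exact_mod_cast Int.ceil_le.2 (by exact_mod_cast hle)
      · rw [abs_le]
        constructor <;> linarith [Int.le_ceil y, Int.ceil_lt_add_one y]
    · refine ⟨⌊y⌋, (hJ i).1.out hn hi ⟨?_, Int.floor_le y⟩, ?_⟩
      · exact_mod_cast Int.le_floor.2 (by exact_mod_cast hle)
      · rw [abs_le]
        constructor <;> linarith [Int.floor_le y, Int.lt_floor_add_one y]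
  have hmin : 0 ≤ min 1 ℓ := le_min zero_le_one hℓ0.le
  have hvol : volume.real (⋃ i, J i) ≤ hfin.toFinset.card * (2 * min 1 ℓ) := by
    refine (measureReal_mono hcover ?_).trans ((measureReal_biUnion_finset_le _ _).trans ?_)
    · refine ne_top_of_le_ne_top ?_ (measure_biUnion_finset_le _ _)
      exact ENNReal.sum_ne_top.2 fun u _ => measure_closedBall_lt_top.ne
    · rw [← nsmul_eq_mul]
      refine Finset.sum_le_card_nsmul _ _ _ fun u _ => ?_
      rw [Measure.real, Real.volume_closedBall, ENNReal.toReal_ofReal (by positivity)]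
  refine ⟨hfin.toFinset, ⌊ℓ⌋₊, ∑ i, N i, ?_, ?_⟩
  · have hL := Nat.floor_le hℓ0.le
    have hlt := hC.trans_le hvol
    set c : ℝ := (hfin.toFinset.card : ℝ)
    refine (mul_le_mul_of_nonneg_left (by linarith : (2 * (⌊ℓ⌋₊ : ℝ) + 1) ≤ 2 * ℓ + 1)
      hK.le).trans ?_
    rcases le_total 1 ℓ with h1 | h1
    · rw [min_eq_left h1] at hlt
      nlinarith
    · rw [min_eq_right h1] at hlt
      have : 3 * K < c := by
        have : (3 * K) * (2 * ℓ) < c * (2 * ℓ) := by linarith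
        exact lt_of_mul_lt_mul_right this (by positivity)
      nlinarith
  · intro u hu
    obtain ⟨i, hi⟩ := Set.mem_iUnion.1 (hfin.mem_toFinset.1 hu)
    refine ⟨N i, (Nat.le_succ _).trans (hN i),
      Finset.single_le_sum (f := N) (fun _ _ => Nat.zero_le _) (Finset.mem_univ i), ?_⟩
    have hNpos : (0 : ℝ) < N i := by exact_mod_cast (Nat.succ_pos _).trans_le (hN i)
    refine ((le_div_iff₀ hNpos).1 (hcount i)).trans ?_
    rw [← Set.ncard_coe_finset]
    refine Nat.cast_le.2 (Set.ncard_le_ncard ?_ (Finset.finite_toSet _))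
    rintro n ⟨h1, h2, h3⟩
    simp only [Finset.coe_filter, Finset.mem_Icc, Set.mem_ofPred_eq]
    refine ⟨⟨h1, h2⟩, ?_⟩
    have := hdist i u hi (a n) h3
    have h4 : (((|u - (a n : ℤ)|).toNat : ℕ) : ℤ) = |u - (a n : ℤ)| :=
      Int.toNat_of_nonneg (abs_nonneg _)
    rw [← h4]
    refine Nat.cast_le.2 (Nat.le_floor ?_)
    have h5 : (((|u - (a n : ℤ)|).toNat : ℕ) : ℝ) = |(u : ℝ) - a n| := by
      have := congrArg (Int.cast : ℤ → ℝ) h4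
      push_cast at this
      exact_mod_cast this
    rw [h5]
    exact this

/-! ### Covering by translates in a finite group -/

/-- Greedy covering: `n` translates of `I` can be chosen with small total mass `w`, such that
the mass `v` of the points outside the corresponding translates of `V` is small. -/
theorem exists_translates {G : Type*} [AddCommGroup G] [Fintype G] [DecidableEq G]
    (w : G → ℝ) (I V : Finset G) (n : ℕ) (hw : ∀ x, 0 ≤ w x) (v : G → ℝ) :
    ∃ S : Finset G,
      ∑ x with ∃ s ∈ S, x - s ∈ I, w x + ∑ x with ∀ s ∈ S, x - s ∉ V, v x ≤
        n * (I.card / Fintype.card G) * ∑ x, w x +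
          (1 - V.card / Fintype.card G) ^ n * ∑ x, v x := by
  have hG : (0 : ℝ) < Fintype.card G := by exact_mod_cast Fintype.card_pos
  have hcount : ∀ (P : Finset G) (f : G → ℝ),
      ∑ s, ∑ x with x - s ∈ P, f x = P.card * ∑ x, f x := by
    intro P f
    simp_rw [Finset.sum_filter]
    rw [Finset.sum_comm, Finset.mul_sum]
    refine Finset.sum_congr rfl fun x _ => ?_
    rw [← (Equiv.subLeft x).sum_comp]
    simp [Equiv.subLeft_apply]
  induction n generalizing v with
  | zero => exact ⟨∅, by simp⟩
  | succ n ih =>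
    set c : ℝ := (1 - V.card / Fintype.card G) ^ n with hc
    -- Average over the next translate `s`; the uncovered mass is weighted by `c`, the factor by
    -- which the remaining `n` translates will shrink it.
    have havg : ∑ s, (∑ x with x - s ∈ I, w x + c * ∑ x with x - s ∉ V, v x) ≤
        ∑ _s : G, (I.card / Fintype.card G * ∑ x, w x +
          c * ((1 - V.card / Fintype.card G) * ∑ x, v x)) := by
      have : ∀ s, ∑ x with x - s ∉ V, v x = ∑ x, v x - ∑ x with x - s ∈ V, v x := fun s => by
        rw [← Finset.sum_filter_add_sum_filter_not Finset.univ (fun x => x - s ∈ V)]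
        ring
      simp_rw [this]
      rw [Finset.sum_add_distrib, hcount, ← Finset.mul_sum, Finset.sum_sub_distrib, hcount]
      simp only [Finset.sum_const, Finset.card_univ, nsmul_eq_mul]
      apply le_of_eq
      field_simp
    obtain ⟨s, -, hs⟩ := Finset.exists_le_of_sum_le Finset.univ_nonempty havg
    obtain ⟨S, hS⟩ := ih (fun x => if x - s ∉ V then v x else 0)
    refine ⟨insert s S, ?_⟩
    have h1 : ∑ x with ∃ t ∈ insert s S, x - t ∈ I, w x ≤
        ∑ x with x - s ∈ I, w x + ∑ x with ∃ t ∈ S, x - t ∈ I, w x := by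
      have : (Finset.univ.filter fun x => ∃ t ∈ insert s S, x - t ∈ I) =
          (Finset.univ.filter fun x => x - s ∈ I) ∪
            (Finset.univ.filter fun x => ∃ t ∈ S, x - t ∈ I) := by
        ext x; simp
      rw [this, ← Finset.sum_union_inter]
      exact le_add_of_nonneg_right (Finset.sum_nonneg fun x _ => hw x)
    have h2 : ∑ x with ∀ t ∈ insert s S, x - t ∉ V, v x =
        ∑ x with ∀ t ∈ S, x - t ∉ V, (if x - s ∉ V then v x else 0) := by
      rw [← Finset.sum_filter, Finset.filter_filter]
      refine Finset.sum_congr ?_ fun _ _ => rfl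
      ext x; simp [and_comm]
    have h3 : ∑ x, (if x - s ∉ V then v x else 0) = ∑ x with x - s ∉ V, v x :=
      (Finset.sum_filter _ _).symm
    rw [h3] at hS
    rw [h2, pow_succ]
    push_cast
    nlinarith

/-! ### Small sets and hitting times -/

/-- Take a small neighbourhood of a point of the support; its singleton is null, so outer regularity
applies. -/
theorem exists_measurableSet_pos_lt {X : Type*} [MetricSpace X] [CompactSpace X]
    [MeasurableSpace X] [BorelSpace X] (μ : Measure X) [IsProbabilityMeasure μ]
    [NullSingletonClass μ] {δ : ℝ} (hδ : 0 < δ) :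
    ∃ B : Set X, MeasurableSet B ∧ 0 < μ B ∧ μ.real B < δ := by
  obtain ⟨x, -, hx⟩ := exists_mem_forall_mem_nhdsWithin_pos_measure (μ := μ) (s := Set.univ)
    (by simp)
  have h0 : μ {x} < ENNReal.ofReal δ := by simpa using hδ
  obtain ⟨O, hO, hOo, hlt⟩ := Set.exists_isOpen_lt_of_lt _ _ h0
  refine ⟨O, hOo.measurableSet, hx O ?_, ?_⟩
  · exact mem_nhdsWithin_of_mem_nhds (hOo.mem_nhds (hO rfl))
  · rw [Measure.real]
    exact (ENNReal.lt_ofReal_iff_toReal_lt (measure_ne_top _ _)).1 hlt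

theorem Ergodic.ae_exists_iterate_mem {X : Type*} [MeasurableSpace X] {μ : Measure X}
    [IsProbabilityMeasure μ] {T : X → X} (hT : Ergodic T μ) {B : Set X} (hB : MeasurableSet B)
    (hpos : 0 < μ B) : ∀ᵐ x ∂μ, ∃ n, T^[n] x ∈ B := by
  have hmeas : MeasurableSet (⋃ n, T^[n] ⁻¹' B) :=
    MeasurableSet.iUnion fun n => (hT.measurable.iterate n) hB
  have hsub : T ⁻¹' (⋃ n, T^[n] ⁻¹' B) ⊆ ⋃ n, T^[n] ⁻¹' B := fun x hx => by
    obtain ⟨n, hn⟩ := Set.mem_iUnion.1 hx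
    exact Set.mem_iUnion.2 ⟨n + 1, hn⟩
  rcases hT.ae_empty_or_univ_of_preimage_ae_le hmeas.nullMeasurableSet
    (Eventually.of_forall hsub) with h | h
  · have h1 : μ (⋃ n, T^[n] ⁻¹' B) = 0 := ae_eq_empty.1 h
    exact absurd (measure_mono_null (Set.subset_iUnion (fun n => T^[n] ⁻¹' B) 0) h1) hpos.ne'
  · filter_upwards [eventuallyEq_univ.1 h] with x hx
    exact Set.mem_iUnion.1 hx

/-- A map to `ZMod q` which decreases by one along orbits outside a small set. -/
theorem Ergodic.exists_phase {X : Type*} [MeasurableSpace X] {μ : Measure X}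
    [IsProbabilityMeasure μ] {T : X → X} (hT : Ergodic T μ) {B : Set X} (hB : MeasurableSet B)
    (hpos : 0 < μ B) (q : ℕ) : ∃ p : X → ZMod q, Measurable p ∧
      ∀ᵐ x ∂μ, ∀ n, (∀ j < n, T^[j] x ∉ B) → p (T^[n] x) = p x - n := by
  classical
  -- The second alternative only makes `Nat.find` total: orbits that never meet `B` get phase 0 and
  -- form a null set.
  have hex : ∀ x, ∃ n, T^[n] x ∈ B ∨ ∀ m, T^[m] x ∉ B := fun x => by
    by_cases h : ∃ n, T^[n] x ∈ B
    · exact h.imp fun n hn => Or.inl hn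
    · exact ⟨0, Or.inr fun m hm => h ⟨m, hm⟩⟩
  refine ⟨fun x => (Nat.find (hex x) : ZMod q), ?_, ?_⟩
  · refine (measurable_of_countable _).comp (measurable_find hex fun n => ?_)
    have : {x | T^[n] x ∈ B ∨ ∀ m, T^[m] x ∉ B} = T^[n] ⁻¹' B ∪ ⋂ m, (T^[m] ⁻¹' B)ᶜ := by
      ext x; simp
    rw [this]
    exact ((hT.measurable.iterate n) hB).union
      (MeasurableSet.iInter fun m => ((hT.measurable.iterate m) hB).compl)
  · filter_upwards [hT.ae_exists_iterate_mem hB hpos] with x hx n hn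
    suffices Nat.find (hex x) = Nat.find (hex (T^[n] x)) + n by
      simp only [this]
      push_cast
      ring
    obtain ⟨m, hm⟩ := hx
    have hnm : ∀ k, T^[k] x ∈ B → n ≤ k := fun k hk => by
      by_contra! hlt
      exact hn k hlt hk
    have hsub : ∀ k, n ≤ k → T^[k - n] (T^[n] x) = T^[k] x := fun k hk => by
      rw [← Function.iterate_add_apply, Nat.sub_add_cancel hk]
    have h1 : T^[Nat.find (hex (T^[n] x)) + n] x ∈ B := by
      rw [Function.iterate_add_apply]
      refine (Nat.find_spec (hex (T^[n] x))).resolve_right fun hall => hall (m - n) ?_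
      rwa [hsub m (hnm m hm)]
    have h2 : T^[Nat.find (hex x)] x ∈ B :=
      (Nat.find_spec (hex x)).resolve_right fun hall => hall m hm
    apply le_antisymm
    · exact Nat.find_min' _ (Or.inl h1)
    · rw [← Nat.le_sub_iff_add_le (hnm _ h2)]
      refine Nat.find_min' _ (Or.inl ?_)
      rwa [hsub _ (hnm _ h2)]

theorem measureReal_exists_iterate_mem_le {X : Type*} [MeasurableSpace X] {μ : Measure X}
    [IsProbabilityMeasure μ] {T : X → X} (hT : MeasurePreserving T μ μ) {B : Set X}
    (hB : MeasurableSet B) (s : Finset ℕ) :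
    μ.real {x | ∃ n ∈ s, T^[n] x ∈ B} ≤ s.card * μ.real B := by
  have : {x | ∃ n ∈ s, T^[n] x ∈ B} = ⋃ n ∈ s, T^[n] ⁻¹' B := by ext; simp
  rw [this]
  refine (measureReal_biUnion_finset_le _ _).trans ?_
  rw [← nsmul_eq_mul]
  refine Finset.sum_le_card_nsmul _ _ _ fun n _ => le_of_eq ?_
  exact (hT.iterate n).measureReal_preimage hB.nullMeasurableSet

theorem card_div_le_cesaroVisits {X : Type*} {T : X → X} {a : ℕ → ℕ} {A : Set X} {x : X} {N : ℕ}
    {s : Finset ℕ} (hs : s ⊆ Finset.Icc 1 N) (h : ∀ n ∈ s, T^[a n] x ∈ A) :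
    (s.card : ℝ) / N ≤ cesaroVisits T a A x N := by
  refine div_le_div_of_nonneg_right ?_ (Nat.cast_nonneg _)
  calc (s.card : ℝ) = ∑ n ∈ s, A.indicator (fun _ => (1 : ℝ)) (T^[a n] x) := by
        rw [Finset.sum_congr rfl fun n hn => Set.indicator_of_mem (h n hn) _]
        simp
    _ ≤ _ := Finset.sum_le_sum_of_subset_of_nonneg hs
        fun n _ _ => Set.indicator_nonneg (fun _ _ => zero_le_one) _

/-! ### A small set visited almost all the time -/

theorem IntervalCondition.exists_sweeping {a : ℕ → ℕ} (h : IntervalCondition a) {X : Type*}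
    [MetricSpace X] [CompactSpace X] [MeasurableSpace X] [BorelSpace X] (μ : Measure X)
    [IsProbabilityMeasure μ] [NullSingletonClass μ] {T : X → X} (hT : Ergodic T μ) (N₀ : ℕ)
    {η : ℝ} (hη : 0 < η) :
    ∃ (D : Set X) (M : ℕ), MeasurableSet D ∧ μ.real D ≤ η ∧
      μ.real {x | ∀ N, N₀ ≤ N → N ≤ M → cesaroVisits T a D x N < 1 - η} ≤ η := by
  classical
  obtain ⟨d, hd⟩ := exists_nat_gt (3 / η)
  have hd0 : (0 : ℝ) < d := lt_trans (by positivity) hd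
  have hdη : 1 / (d : ℝ) ≤ η / 3 := by
    rw [div_lt_iff₀ hη] at hd
    rw [div_le_div_iff₀ hd0 (by norm_num)]
    linarith
  obtain ⟨k, hk⟩ : ∃ k : ℕ, Real.exp (-(k + 1 : ℝ)) ≤ η / 3 := by
    have ht : Tendsto (fun k : ℕ => Real.exp (-(k + 1 : ℝ))) atTop (nhds 0) :=
      Real.tendsto_exp_neg_atTop_nhds_zero.comp
        (tendsto_atTop_add_const_right _ _ tendsto_natCast_atTop_atTop)
    exact (ht.eventually_le_const (by positivity : (0 : ℝ) < η / 3)).exists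
  obtain ⟨U, L, M, hU, hUN⟩ := h.exists_finset (N₀ + 1) (K := d * (k + 1)) (ε := min η (1 / 2))
    (by positivity) (by positivity) ((min_le_right _ _).trans_lt (by norm_num))
  obtain ⟨R, hR⟩ : ∃ R : ℕ, ∀ u ∈ U, |u| ≤ R :=
    ⟨∑ u ∈ U, u.natAbs, fun u hu => by
      rw [Int.abs_eq_natAbs]
      exact_mod_cast Finset.single_le_sum (f := Int.natAbs) (fun _ _ => Nat.zero_le _) hu⟩
  -- With `m` translates, `m |I| / q ≤ 1/d` and `m |U| / q ≥ k + 1`, so both masses are at most `η /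
  -- 3`. Also `q ≥ m > 2R`, so `U` embeds into `ZMod q`.
  set m : ℕ := 2 * R + 1 with hm
  set q : ℕ := (2 * L + 1) * d * m with hq
  have hdpos : 0 < d := by exact_mod_cast hd0
  have hmq : m ≤ q := Nat.le_mul_of_pos_left _ (by positivity)
  have : NeZero q := ⟨by omega⟩
  set V : Finset (ZMod q) := U.image (fun u : ℤ => (u : ZMod q)) with hV
  set I : Finset (ZMod q) := (Finset.Icc (-(L : ℤ)) L).image (fun u : ℤ => (u : ZMod q)) with hI
  have hVcard : V.card = U.card := by
    refine Finset.card_image_of_injOn fun u hu v hv huv => ?_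
    have h1 := (ZMod.intCast_eq_intCast_iff_dvd_sub u v q).1 huv
    have h2 := abs_le.1 (hR u hu)
    have h3 := abs_le.1 (hR v hv)
    have h4 := Int.eq_zero_of_abs_lt_dvd h1 (by rw [abs_lt]; constructor <;> omega)
    omega
  have hIcard : I.card ≤ 2 * L + 1 := by
    refine Finset.card_image_le.trans ?_
    rw [Int.card_Icc]
    omega
  -- `Amax` bounds every `a n` with `n ≤ M`; `B` is so small that few orbits meet it before time
  -- `Amax`.
  set Amax : ℕ := ∑ n ∈ Finset.Icc 1 M, a n with hAmax
  obtain ⟨B, hB, hB0, hBδ⟩ := exists_measurableSet_pos_lt μ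
    (δ := η / 3 / (Amax + 1)) (by positivity)
  obtain ⟨p, hp, hpT⟩ := hT.exists_phase hB hB0 q
  have hmass : ∀ (P : ZMod q → Prop) [DecidablePred P],
      ∑ c with P c, μ.real (p ⁻¹' {c}) = μ.real {x | P (p x)} := by
    intro P _
    rw [sum_measureReal_preimage_singleton _ fun c _ => hp (measurableSet_singleton c)]
    congr 1
    ext x; simp
  obtain ⟨S, hS⟩ := exists_translates (fun c => μ.real (p ⁻¹' {c})) I V m
    (fun _ => measureReal_nonneg) (fun c => μ.real (p ⁻¹' {c}))
  have htot : ∑ c, μ.real (p ⁻¹' {c}) = 1 := by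
    have := hmass fun _ => True
    simpa using this
  rw [hmass, hmass, htot, ZMod.card, hVcard, mul_one, mul_one] at hS
  have hm0 : (0 : ℝ) < m := by positivity
  have hqR : (q : ℝ) = (2 * L + 1) * d * m := by rw [hq]; push_cast; ring
  have hq0 : (0 : ℝ) < q := by rw [hqR]; positivity
  have hb1 : (m : ℝ) * (I.card / q) ≤ η / 3 := by
    refine le_trans ?_ hdη
    have : (I.card : ℝ) ≤ 2 * L + 1 := by exact_mod_cast hIcard
    rw [← mul_div_assoc, div_le_div_iff₀ hq0 hd0, hqR, one_mul]
    calc (m : ℝ) * I.card * d ≤ m * (2 * L + 1) * d := by gcongr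
      _ = _ := by ring
  have hb2 : (1 - (U.card : ℝ) / q) ^ m ≤ η / 3 := by
    refine le_trans ?_ hk
    have hle : (U.card : ℝ) / q ≤ 1 := by
      rw [div_le_one hq0]
      have := Finset.card_le_univ V
      rw [hVcard, ZMod.card] at this
      exact_mod_cast this
    calc (1 - (U.card : ℝ) / q) ^ m ≤ Real.exp (-((U.card : ℝ) / q)) ^ m :=
          pow_le_pow_left₀ (by linarith) (Real.one_sub_le_exp_neg _) m
      _ = Real.exp (-(m * ((U.card : ℝ) / q))) := by rw [← Real.exp_nat_mul]; ring_nf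
      _ ≤ _ := by
        apply Real.exp_le_exp.2
        apply neg_le_neg
        rw [← mul_div_assoc, le_div_iff₀ hq0, hqR]
        calc ((k : ℝ) + 1) * ((2 * L + 1) * d * m) = m * (d * (k + 1) * (2 * L + 1)) := by ring
          _ ≤ _ := by gcongr
  set D : Set X := {x | ∃ s ∈ S, p x - s ∈ I} with hD
  have hDm : MeasurableSet D :=
    hp (t := {c | ∃ s ∈ S, c - s ∈ I}) (Set.toFinite _).measurableSet
  have hn1 : 0 ≤ μ.real D := measureReal_nonneg
  have hn2 : 0 ≤ μ.real {x | ∀ s ∈ S, p x - s ∉ V} := measureReal_nonneg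
  refine ⟨D, M, hDm, by linarith, ?_⟩
  have hbad := measureReal_exists_iterate_mem_le hT.toMeasurePreserving hB (Finset.range Amax)
  have hbad' : (Finset.range Amax).card * μ.real B ≤ η / 3 := by
    rw [Finset.card_range]
    rw [lt_div_iff₀ (by positivity)] at hBδ
    nlinarith [measureReal_nonneg (μ := μ) (s := B)]
  have hsub : {x | ∀ N, N₀ ≤ N → N ≤ M → cesaroVisits T a D x N < 1 - η} ≤ᵐ[μ]
      ({x | ∀ s ∈ S, p x - s ∉ V} ∪ {x | ∃ n ∈ Finset.range Amax, T^[n] x ∈ B} : Set X) := by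
    filter_upwards [hpT] with x hx hlow
    by_contra hnot
    change ¬ ((∀ s ∈ S, p x - s ∉ V) ∨ ∃ n ∈ Finset.range Amax, T^[n] x ∈ B) at hnot
    push Not at hnot
    obtain ⟨⟨s, hs, hsV⟩, hnB⟩ := hnot
    obtain ⟨u, hu, hus⟩ := Finset.mem_image.1 hsV
    obtain ⟨N, hN1, hN2, hN⟩ := hUN u hu
    have hNpos : (0 : ℝ) < N := by exact_mod_cast (Nat.succ_pos _).trans_le hN1
    refine (hlow N ((Nat.le_succ _).trans hN1) hN2).not_ge (le_trans ?_
      (card_div_le_cesaroVisits (Finset.filter_subset (fun n => |u - (a n : ℤ)| ≤ L) _) ?_))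
    · rw [le_div_iff₀ hNpos]
      refine le_trans ?_ hN
      gcongr
      exact min_le_left _ _
    · intro n hn
      obtain ⟨hn1, hn2⟩ := Finset.mem_filter.1 hn
      have hle : a n ≤ Amax := by
        refine Finset.single_le_sum (f := a) (fun _ _ => Nat.zero_le _) ?_
        rw [Finset.mem_Icc] at hn1 ⊢
        omega
      refine ⟨s, hs, Finset.mem_image.2 ⟨u - a n, ?_, ?_⟩⟩
      · rw [Finset.mem_Icc]
        exact abs_le.1 hn2
      -- The phase at time `a n` is `p x - a n = s + (u - a n)`.
      · rw [hx (a n) fun j hj => hnB j (Finset.mem_range.2 (hj.trans_le hle))]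
        push_cast
        rw [hus]
        ring
  refine (ENNReal.toReal_mono (measure_ne_top _ _) (measure_mono_ae hsub)).trans
    ((measureReal_union_le _ _).trans ?_)
  linarith

/-! ### Combining the scales -/

theorem measure_iUnion_le_of_geometric {X : Type*} [MeasurableSpace X] {μ : Measure X}
    {D : ℕ → Set X} {b : ℝ} (hb : 0 ≤ b)
    (h : ∀ j, μ (D j) ≤ ENNReal.ofReal (b * (1 / 2) ^ j)) :
    μ (⋃ j, D j) ≤ ENNReal.ofReal (b * 2) := by
  refine (measure_iUnion_le D).trans ((ENNReal.tsum_le_tsum h).trans (le_of_eq ?_))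
  rw [← ENNReal.ofReal_tsum_of_nonneg (fun j => by positivity)
    (summable_geometric_two.mul_left b), tsum_mul_left, tsum_geometric_two]

theorem cesaroVisits_nonneg {X : Type*} (T : X → X) (a : ℕ → ℕ) (A : Set X) (x : X) (N : ℕ) :
    0 ≤ cesaroVisits T a A x N :=
  div_nonneg (Finset.sum_nonneg fun _ _ => Set.indicator_nonneg (fun _ _ => zero_le_one) _)
    (Nat.cast_nonneg _)

theorem cesaroVisits_mono_of_orbit {X : Type*} {T : X → X} {a : ℕ → ℕ} {A D : Set X} {x : X}
    {N : ℕ} (h : ∀ n ∈ Finset.Icc 1 N, T^[a n] x ∈ D → T^[a n] x ∈ A) :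
    cesaroVisits T a D x N ≤ cesaroVisits T a A x N := by
  classical
  refine div_le_div_of_nonneg_right (Finset.sum_le_sum fun n hn => ?_) (Nat.cast_nonneg _)
  have := h n hn
  simp only [Set.indicator_apply]
  split_ifs <;> first | tauto | norm_num

theorem cesaroVisits_le_one_sub {X : Type*} (T : X → X) (a : ℕ → ℕ) (A : Set X) (x : X)
    (N : ℕ) : cesaroVisits T a A x N ≤ 1 - cesaroVisits T a Aᶜ x N := by
  rw [le_sub_iff_add_le, cesaroVisits, cesaroVisits, ← add_div, ← Finset.sum_add_distrib]
  simp_rw [Set.indicator_self_add_compl_apply]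
  simpa using div_self_le_one (N : ℝ)

theorem limsup_eq_one_and_liminf_eq_zero {f : ℕ → ℝ} (h0 : ∀ N, 0 ≤ f N) (h1 : ∀ N, f N ≤ 1)
    (hhigh : ∀ c < 1, ∃ᶠ N in atTop, c ≤ f N) (hlow : ∀ c > 0, ∃ᶠ N in atTop, f N ≤ c) :
    limsup f atTop = 1 ∧ liminf f atTop = 0 := by
  have hub : IsBoundedUnder (· ≤ ·) atTop f := isBoundedUnder_of ⟨1, h1⟩
  have hlb : IsBoundedUnder (· ≥ ·) atTop f := isBoundedUnder_of ⟨0, h0⟩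
  constructor
  · refine le_antisymm (limsup_le_of_le hlb.isCoboundedUnder_le (Eventually.of_forall h1)) ?_
    exact le_of_forall_lt_imp_le_of_dense fun c hc => le_limsup_of_frequently_le (hhigh c hc) hub
  · refine le_antisymm ?_ (le_liminf_of_le hub.isCoboundedUnder_ge (Eventually.of_forall h0))
    exact le_of_forall_gt_imp_ge_of_dense fun c hc => liminf_le_of_frequently_le (hlow c hc) hlb

theorem Nat.frequently_atTop_of_eventually_block {P : ℕ → Prop} {M : ℕ → ℕ} (r : ℕ)
    (hr : r < 2) (h : ∀ᶠ k in atTop, k % 2 = r → ∃ N, k ≤ N ∧ N ≤ M k ∧ P N) :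
    ∃ᶠ N in atTop, P N := by
  obtain ⟨K, hK⟩ := eventually_atTop.1 h
  refine frequently_atTop.2 fun b => ?_
  obtain ⟨N, h1, -, h3⟩ := hK (2 * (K + b) + r) (by omega) (by omega)
  exact ⟨N, by omega, h3⟩

theorem mainTheorem7 (a : ℕ → ℕ) (ha : ∀ n, 1 ≤ n → 0 < a n) (h : IntervalCondition a) :
    StrongSweepingOut.{u} a := by
  classical
  intro X _ _ _ _ μ _ _ T hT ε hε
  choose! D₀ M₀ hD₀ using fun (k : ℕ) (η : ℝ) (hη : 0 < η) => h.exists_sweeping μ hT k hη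
  -- The next scale is chosen after `M k`, so that the union `E k` of all later sets satisfies `M k
  -- * μ (E k) ≤ c k`: few orbits enter it at a time `a n` with `n ≤ M k`.
  let c : ℕ → ℝ := fun k => Nat.rec (ε / 4) (fun k c => c / (2 * (M₀ k c + 1))) k
  have hcs : ∀ k, c (k + 1) = c k / (2 * (M₀ k (c k) + 1)) := fun _ => rfl
  set D : ℕ → Set X := fun k => D₀ k (c k) with hDdef
  set M : ℕ → ℕ := fun k => M₀ k (c k) with hMdef
  have hcpos : ∀ k, 0 < c k := by
    intro k
    induction k with
    | zero => change 0 < ε / 4; positivity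
    | succ k ih => rw [hcs]; positivity
  have hD : ∀ k, MeasurableSet (D k) := fun k => (hD₀ k _ (hcpos k)).1
  have hDμ : ∀ k, μ (D k) ≤ ENNReal.ofReal (c k) := fun k =>
    (ENNReal.le_ofReal_iff_toReal_le (measure_ne_top _ _) (hcpos k).le).2
      (hD₀ k _ (hcpos k)).2.1
  have hlow : ∀ k, μ.real {x | ∀ N, k ≤ N → N ≤ M k → cesaroVisits T a (D k) x N < 1 - c k} ≤
      c k := fun k => (hD₀ k _ (hcpos k)).2.2
  have hcgeo : ∀ k j, c (k + j) ≤ c k * (1 / 2) ^ j := by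
    intro k j
    induction j with
    | zero => simp
    | succ j ih =>
      rw [← add_assoc, hcs, pow_succ, ← mul_assoc]
      calc c (k + j) / (2 * (M₀ (k + j) (c (k + j)) + 1)) ≤ c (k + j) / 2 := by
            refine div_le_div_of_nonneg_left (hcpos _).le two_pos ?_
            linarith [Nat.cast_nonneg (α := ℝ) (M₀ (k + j) (c (k + j)))]
        _ ≤ _ := by linarith
  have hc4 : ∀ k, c k ≤ ε / 4 * (1 / 2) ^ k := fun k => by
    have := hcgeo 0 k
    rwa [zero_add] at this
  have hDgeo : ∀ k, μ (⋃ j, D (k + j)) ≤ ENNReal.ofReal (c k * 2) := fun k =>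
    measure_iUnion_le_of_geometric (hcpos k).le fun j =>
      (hDμ (k + j)).trans (ENNReal.ofReal_le_ofReal (hcgeo k j))
  set E : ℕ → Set X := fun k => ⋃ j, D (k + 1 + j) with hEdef
  have hDE : ∀ {k j}, k < j → D j ⊆ E k := fun {k j} hkj => by
    obtain ⟨i, rfl⟩ := Nat.exists_eq_add_of_le (Nat.succ_le_of_lt hkj)
    exact Set.subset_iUnion (fun j => D (k + 1 + j)) i
  have hE : ∀ k, MeasurableSet (E k) := fun k => MeasurableSet.iUnion fun j => hD _
  have hEμ : ∀ k, (M k : ℝ) * μ.real (E k) ≤ c k := by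
    intro k
    have h1 : μ.real (E k) ≤ c (k + 1) * 2 :=
      (ENNReal.le_ofReal_iff_toReal_le (measure_ne_top μ (E k))
        (mul_nonneg (hcpos (k + 1)).le zero_le_two)).1 (hDgeo (k + 1))
    have h2 : c (k + 1) * 2 * (M k + 1) = c k := by
      rw [show c (k + 1) = c k / (2 * (M k + 1)) from rfl]
      field_simp
    calc (M k : ℝ) * μ.real (E k) ≤ (M k + 1) * (c (k + 1) * 2) := by gcongr; linarith
      _ = c k := by rw [← h2]; ring
  set Bad : ℕ → Set X := fun k =>
    {x | ∀ N, k ≤ N → N ≤ M k → cesaroVisits T a (D k) x N < 1 - c k} ∪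
      {x | ∃ n ∈ (Finset.Icc 1 (M k)).image a, T^[n] x ∈ E k} with hBad
  have hBadμ : ∀ k, μ (Bad k) ≤ ENNReal.ofReal (ε / 2 * (1 / 2) ^ k) := by
    intro k
    refine (ENNReal.le_ofReal_iff_toReal_le (measure_ne_top _ _) (by positivity)).2 ?_
    have h1 := measureReal_exists_iterate_mem_le hT.toMeasurePreserving (hE k)
      ((Finset.Icc 1 (M k)).image a)
    have h2 : (((Finset.Icc 1 (M k)).image a).card : ℝ) * μ.real (E k) ≤ M k * μ.real (E k) := by
      gcongr
      refine Finset.card_image_le.trans ?_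
      simp
    have h3 := hc4 k
    have h4 := measureReal_union_le (μ := μ)
      {x | ∀ N, k ≤ N → N ≤ M k → cesaroVisits T a (D k) x N < 1 - c k}
      {x | ∃ n ∈ (Finset.Icc 1 (M k)).image a, T^[n] x ∈ E k}
    have h5 := hlow k
    have h6 := hEμ k
    change μ.real (Bad k) ≤ _
    linarith
  have hc0 : Tendsto c atTop (nhds 0) := by
    refine squeeze_zero (fun k => (hcpos k).le) (g := fun k => ε / 4 * (1 / 2) ^ k)
      hc4 ?_
    simpa using (tendsto_pow_atTop_nhds_zero_of_lt_one (r := (1 / 2 : ℝ)) (by norm_num)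
      (by norm_num)).const_mul (ε / 4)
  refine ⟨⋃ i, D (2 * i) \ E (2 * i), MeasurableSet.iUnion fun i => (hD _).diff (hE _), ?_, ?_⟩
  · refine (measure_mono ?_).trans_lt ((hDgeo 0).trans_lt ?_)
    · refine Set.iUnion_subset fun i x hx => Set.mem_iUnion.2 ⟨2 * i, ?_⟩
      rw [zero_add]
      exact hx.1
    · refine (ENNReal.ofReal_lt_ofReal_iff hε).2 ?_
      change ε / 4 * 2 < ε
      linarith
  set A : Set X := ⋃ i, D (2 * i) \ E (2 * i) with hA
  have hsum : ∑' k, μ (Bad k) ≠ ⊤ := by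
    refine ne_top_of_le_ne_top ?_ (ENNReal.tsum_le_tsum hBadμ)
    rw [← ENNReal.ofReal_tsum_of_nonneg (fun j => by positivity)
      (summable_geometric_two.mul_left (ε / 2))]
    exact ENNReal.ofReal_ne_top
  filter_upwards [ae_eventually_notMem hsum] with x hx
  have hgood : ∀ᶠ k in atTop, (∃ N, k ≤ N ∧ N ≤ M k ∧ 1 - c k ≤ cesaroVisits T a (D k) x N) ∧
      ∀ n ∈ Finset.Icc 1 (M k), T^[a n] x ∉ E k := by
    filter_upwards [hx] with k hk
    constructor
    · by_contra! hcon
      exact hk (Or.inl hcon)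
    · exact fun n hn hmem => hk (Or.inr ⟨a n, Finset.mem_image_of_mem a hn, hmem⟩)
  refine limsup_eq_one_and_liminf_eq_zero (cesaroVisits_nonneg T a A x) (fun N => ?_) ?_ ?_
  · linarith [cesaroVisits_le_one_sub T a A x N, cesaroVisits_nonneg T a Aᶜ x N]
  · intro b hb
    refine Nat.frequently_atTop_of_eventually_block (M := M) 0 two_pos ?_
    filter_upwards [hgood, hc0.eventually_lt_const (sub_pos.2 hb)] with k hk hck hpar
    obtain ⟨⟨N, h1, h2, h3⟩, h4⟩ := hk
    refine ⟨N, h1, h2, le_trans (by linarith) (h3.trans (cesaroVisits_mono_of_orbit ?_))⟩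
    intro n hn hmem
    have hk2 : 2 * (k / 2) = k := by omega
    refine Set.mem_iUnion.2 ⟨k / 2, ?_⟩
    rw [hk2]
    exact ⟨hmem, h4 n (Finset.Icc_subset_Icc_right h2 hn)⟩
  · intro b hb
    refine Nat.frequently_atTop_of_eventually_block (M := M) 1 one_lt_two ?_
    filter_upwards [hgood, hc0.eventually_lt_const hb] with k hk hck hpar
    obtain ⟨⟨N, h1, h2, h3⟩, h4⟩ := hk
    refine ⟨N, h1, h2, ?_⟩
    have h5 : cesaroVisits T a (D k) x N ≤ cesaroVisits T a Aᶜ x N := by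
      refine cesaroVisits_mono_of_orbit fun n hn hmem hmemA => ?_
      obtain ⟨i, hi, hiE⟩ := Set.mem_iUnion.1 hmemA
      -- A point of `D k` in `D (2i) \ E (2i)` has `k ≤ 2i`; avoiding `E k` forces `k = 2i`,
      -- impossible for odd `k`.
      rcases lt_trichotomy k (2 * i) with hlt | heq | hgt
      · exact h4 n (Finset.Icc_subset_Icc_right h2 hn) (hDE hlt hi)
      · omega
      · exact hiE (hDE hgt hmem)
    linarith [cesaroVisits_le_one_sub T a A x N]
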